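/- Let $0<\lambda<1$. The HK$(+1,\lambda)$ transformation is built by cutting and stacking as follows. Column $C_0$ consists of the single level $[0,1)$. Given column $C_k$ with levels $C_k(0),\dots,C_k(h_k-1)$ (half-open intervals), cut every level of length $w$ into a left piece of length $w/(1+\lambda)$ and a right piece of length $\lambda w/(1+\lambda)$. Column $C_{k+1}$ consists of the left pieces (in the order of $C_k$), followed by the right pieces (in the order of $C_k$), followed by $2h_k+1$ new intervals (spacers) of arbitrary positive lengths, placed side by side on the line to the right of all intervals used so far; thus $h_0=1$ and $h_{k+1}=4h_k+1$. Let $X$ be the union of all levels of all columns, $\mu$ the Lebesgue measure on the Borel sets $\mathcal B$ of $X$, and $S:X\to X$ the map which, for every $k$ and every $0\le i<h_k-1$, sends $C_k(i)$ onto $C_k(i+1)$ by the increasing affine map. Then $S$ is a nonsingular transformation of $(X,\mathcal B,\mu)$, that is, $S$ is measurable, $\mu(S^{-1}A)=0$ if and only if $\mu(A)=0$ for all $A\in\mathcal B$, and $S$ has a measurable inverse almost everywhere. Moreover $S$ is ergodic with isometric coefficients: whenever $(Y,d)$ is a separable metric space, $T:Y\to Y$ is an isometry (not necessarily surjective), and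 $\phi:X\to Y$ is a Borel map with $T\circ\phi=\phi\circ S$ $\mu$-almost everywhere, there is a point $y\in Y$ such that $\phi(x)=y$ for $\mu$-almost every $x\in X$. -/

import Mathlib

open MeasureTheory

namespace HKTower

/-- Heights of the columns: `h₀ = 1`; column `k + 1` consists of two copies of column `k` followed
by `2 h_k + 1` spacers, so `h_{k+1} = 4 h_k + 1`. -/
def height : ℕ → ℕ
  | 0 => 1
  | k + 1 => 2 * height k + (2 * height k + 1)

/-- Right endpoint of the interval `[0, b_k)` which is the union of the levels of column `k`.
The number `ℓ k j` is the length of the `j`-th spacer (`0 ≤ j < 2 h_k + 1`) added to column `k`. -/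
noncomputable def rightEnd (ℓ : ℕ → ℕ → ℝ) : ℕ → ℝ
  | 0 => 1
  | k + 1 => rightEnd ℓ k + ∑ j ∈ Finset.range (2 * height k + 1), ℓ k j

/-- Length of the `i`-th level of column `k` (meaningful for `i < height k`). An interval of length
`w` is cut into a left piece of length `w / (1 + lam)` and a right piece of length
`lam * w / (1 + lam)`. The left pieces come first, then the right pieces, then the spacers. -/
noncomputable def levelLength (lam : ℝ) (ℓ : ℕ → ℕ → ℝ) : ℕ → ℕ → ℝ
  | 0, _ => 1
  | k + 1, i =>
    if i < height k then levelLength lam ℓ k i / (1 + lam)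
    else if i < 2 * height k then lam * levelLength lam ℓ k (i - height k) / (1 + lam)
    else ℓ k (i - 2 * height k)

/-- Left endpoint of the `i`-th level of column `k` (meaningful for `i < height k`). The new spacers
are placed side by side on the line, to the right of everything used so far. -/
noncomputable def levelLeft (lam : ℝ) (ℓ : ℕ → ℕ → ℝ) : ℕ → ℕ → ℝ
  | 0, _ => 0
  | k + 1, i =>
    if i < height k then levelLeft lam ℓ k i
    else if i < 2 * height k then
      levelLeft lam ℓ k (i - height k) + levelLength lam ℓ k (i - height k) / (1 + lam)
    else rightEnd ℓ k + ∑ j ∈ Finset.range (i - 2 * height k), ℓ k j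

/-- The `i`-th level of column `k`, a half-open interval. -/
def level (lam : ℝ) (ℓ : ℕ → ℕ → ℝ) (k i : ℕ) : Set ℝ :=
  Set.Ico (levelLeft lam ℓ k i) (levelLeft lam ℓ k i + levelLength lam ℓ k i)

/-- The phase space: the union of all levels of all columns. -/
def space (lam : ℝ) (ℓ : ℕ → ℕ → ℝ) : Set ℝ :=
  {x | ∃ k i, i < height k ∧ x ∈ level lam ℓ k i}

/-- Lebesgue measure on the phase space. -/
noncomputable def measure (lam : ℝ) (ℓ : ℕ → ℕ → ℝ) : Measure (space lam ℓ) :=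
  Measure.comap Subtype.val volume

/-- The increasing affine map taking level `i` of column `k` onto level `i + 1`. -/
noncomputable def columnMap (lam : ℝ) (ℓ : ℕ → ℕ → ℝ) (k i : ℕ) (x : ℝ) : ℝ :=
  levelLeft lam ℓ k (i + 1) +
    (x - levelLeft lam ℓ k i) * (levelLength lam ℓ k (i + 1) / levelLength lam ℓ k i)

open Classical in
/-- The common extension of all column maps. The choice of the column `p.1` and of the level `p.2`
below its top does not matter (`realMap_eq`), and one exists for each point of the phase space
(`exists_not_top`). -/
noncomputable def realMap (lam : ℝ) (ℓ : ℕ → ℕ → ℝ) (x : ℝ) : ℝ :=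
  if h : ∃ p : ℕ × ℕ, p.2 + 1 < height p.1 ∧ x ∈ level lam ℓ p.1 p.2 then
    columnMap lam ℓ h.choose.1 h.choose.2 x
  else x

section facts

variable {lam : ℝ} {ℓ : ℕ → ℕ → ℝ}

theorem height_pos (k : ℕ) : 0 < height k := by
  cases k <;> simp [height]

theorem levelLength_pos (hlam : 0 < lam) (hℓ : ∀ k j, 0 < ℓ k j) (k i : ℕ) :
    0 < levelLength lam ℓ k i := by
  induction k generalizing i with
  | zero => simp [levelLength]
  | succ k ih =>
    have h1 := ih i
    have h2 := ih (i - height k)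
    have h3 := hℓ k (i - 2 * height k)
    unfold levelLength
    split_ifs <;> positivity

theorem levelLength_left {k i : ℕ} (hi : i < height k) :
    levelLength lam ℓ (k + 1) i = levelLength lam ℓ k i / (1 + lam) := by
  simp [levelLength, hi]

theorem levelLeft_left {k i : ℕ} (hi : i < height k) :
    levelLeft lam ℓ (k + 1) i = levelLeft lam ℓ k i := by
  simp [levelLeft, hi]

theorem levelLength_right {k i : ℕ} (hi : i < height k) :
    levelLength lam ℓ (k + 1) (i + height k) = lam * levelLength lam ℓ k i / (1 + lam) := by
  have h : i + height k < 2 * height k := by omega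
  simp [levelLength, h]

theorem levelLeft_right {k i : ℕ} (hi : i < height k) :
    levelLeft lam ℓ (k + 1) (i + height k) =
      levelLeft lam ℓ k i + levelLength lam ℓ k i / (1 + lam) := by
  have h : i + height k < 2 * height k := by omega
  simp [levelLeft, h]

/-- A point of level `i` of column `k` lies in its left piece or in its right piece. -/
theorem mem_level_succ (hlam : 0 < lam) {k i : ℕ} (hi : i < height k) {x : ℝ}
    (hx : x ∈ level lam ℓ k i) :
    x ∈ level lam ℓ (k + 1) i ∨ x ∈ level lam ℓ (k + 1) (i + height k) := by
  have e : levelLength lam ℓ k i / (1 + lam) + lam * levelLength lam ℓ k i / (1 + lam) =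
      levelLength lam ℓ k i := by
    field_simp
  simp only [level, Set.mem_Ico, levelLength_left hi, levelLeft_left hi, levelLength_right hi,
    levelLeft_right hi] at hx ⊢
  rcases lt_or_ge x (levelLeft lam ℓ k i + levelLength lam ℓ k i / (1 + lam)) with h | h
  · exact Or.inl ⟨hx.1, h⟩
  · exact Or.inr ⟨h, by linarith [hx.2]⟩

/-- Each point of the phase space lies below the top of some column. -/
theorem exists_not_top (hlam : 0 < lam) {x : ℝ} (hx : x ∈ space lam ℓ) :
    ∃ p : ℕ × ℕ, p.2 + 1 < height p.1 ∧ x ∈ level lam ℓ p.1 p.2 := by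
  obtain ⟨k, i, hi, hx⟩ := hx
  rcases mem_level_succ hlam hi hx with h | h
  · exact ⟨(k + 1, i), by simp only [height]; omega, h⟩
  · exact ⟨(k + 1, i + height k), by simp only [height]; omega, h⟩

theorem columnMap_mem (hlam : 0 < lam) (hℓ : ∀ k j, 0 < ℓ k j) {k i : ℕ} {x : ℝ}
    (hx : x ∈ level lam ℓ k i) : columnMap lam ℓ k i x ∈ level lam ℓ k (i + 1) := by
  have h1 := levelLength_pos hlam hℓ k i
  have h2 := levelLength_pos hlam hℓ k (i + 1)
  obtain ⟨ha, hb⟩ := hx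
  refine ⟨?_, ?_⟩
  · have : 0 ≤ x - levelLeft lam ℓ k i := by linarith
    unfold columnMap
    have := mul_nonneg this (div_pos h2 h1).le
    linarith
  · unfold columnMap
    have h3 : x - levelLeft lam ℓ k i < levelLength lam ℓ k i := by linarith
    have h4 := mul_lt_mul_of_pos_right h3 (div_pos h2 h1)
    rw [mul_div_cancel₀ _ h1.ne'] at h4
    linarith

theorem realMap_mapsTo (hlam : 0 < lam) (hℓ : ∀ k j, 0 < ℓ k j) :
    Set.MapsTo (realMap lam ℓ) (space lam ℓ) (space lam ℓ) := by
  intro x hx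
  have h := exists_not_top hlam hx
  rw [realMap, dif_pos h]
  exact ⟨_, _, h.choose_spec.1, columnMap_mem hlam hℓ h.choose_spec.2⟩

theorem sum_mono (hℓ : ∀ k j, 0 < ℓ k j) (k : ℕ) {m n : ℕ} (h : m ≤ n) :
    ∑ j ∈ Finset.range m, ℓ k j ≤ ∑ j ∈ Finset.range n, ℓ k j :=
  Finset.sum_le_sum_of_subset_of_nonneg (Finset.range_mono h) fun j _ _ => (hℓ k j).le

/-- A point of a level of column `k + 1` lies in the left piece of a level of column `k`, in the
right piece of such a level, or in a spacer. -/
theorem mem_level_succ_cases (hlam : 0 < lam) (hℓ : ∀ k j, 0 < ℓ k j) {k i : ℕ} {x : ℝ}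
    (hx : x ∈ level lam ℓ (k + 1) i) :
    (i < height k ∧ x ∈ level lam ℓ k i ∧
        x < levelLeft lam ℓ k i + levelLength lam ℓ k i / (1 + lam)) ∨
      (∃ j, j < height k ∧ i = j + height k ∧ x ∈ level lam ℓ k j ∧
        levelLeft lam ℓ k j + levelLength lam ℓ k j / (1 + lam) ≤ x) ∨
      (2 * height k ≤ i ∧
        rightEnd ℓ k + ∑ j ∈ Finset.range (i - 2 * height k), ℓ k j ≤ x ∧
        x < rightEnd ℓ k + ∑ j ∈ Finset.range (i - 2 * height k + 1), ℓ k j) := by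
  by_cases h2 : i < 2 * height k
  · by_cases h1 : i < height k
    · left
      have hp := levelLength_pos hlam hℓ k i
      have : levelLength lam ℓ k i / (1 + lam) ≤ levelLength lam ℓ k i :=
        div_le_self hp.le (by linarith)
      simp only [level, Set.mem_Ico, levelLength_left h1, levelLeft_left h1] at hx ⊢
      exact ⟨h1, ⟨hx.1, by linarith [hx.2]⟩, hx.2⟩
    · right; left
      have h3 : i - height k < height k := by omega
      obtain ⟨j, rfl⟩ : ∃ j, i = j + height k := ⟨i - height k, by omega⟩
      rw [Nat.add_sub_cancel] at h3
      have hp := levelLength_pos hlam hℓ k j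
      have e : levelLength lam ℓ k j / (1 + lam) + lam * levelLength lam ℓ k j / (1 + lam) =
          levelLength lam ℓ k j := by
        field_simp
      have hq : 0 < levelLength lam ℓ k j / (1 + lam) := by positivity
      simp only [level, Set.mem_Ico, levelLength_right h3, levelLeft_right h3] at hx ⊢
      exact ⟨j, h3, rfl, ⟨by linarith [hx.1], by linarith [hx.2]⟩, hx.1⟩
  · right; right
    have h1 : ¬ i < height k := by omega
    simp only [level, levelLeft, levelLength, h1, h2, if_false, Set.mem_Ico] at hx
    rw [Finset.sum_range_succ]
    exact ⟨by omega, hx.1, by linarith [hx.2]⟩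

/-- The levels of column `k` lie in `[0, b_k)`. -/
theorem level_subset (hlam : 0 < lam) (hℓ : ∀ k j, 0 < ℓ k j) {k i : ℕ} (hi : i < height k) :
    level lam ℓ k i ⊆ Set.Ico 0 (rightEnd ℓ k) := by
  have sum_nonneg : ∀ k n, 0 ≤ ∑ j ∈ Finset.range n, ℓ k j := fun k n =>
    Finset.sum_nonneg fun j _ => (hℓ k j).le
  have end_nonneg : ∀ k, 0 ≤ rightEnd ℓ k := by
    intro k
    induction k with
    | zero => simp [rightEnd]
    | succ k ih => exact add_nonneg ih (sum_nonneg _ _)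
  induction k generalizing i with
  | zero => simp [level, levelLeft, levelLength, rightEnd]
  | succ k ih =>
    intro x hx
    have hmono : rightEnd ℓ k ≤ rightEnd ℓ (k + 1) := by
      simp only [rightEnd]
      linarith [sum_nonneg k (2 * height k + 1)]
    rcases mem_level_succ_cases hlam hℓ hx with ⟨h, hm, -⟩ | ⟨j, h, -, hm, -⟩ | ⟨h, ha, hb⟩
    · exact ⟨(ih h hm).1, (ih h hm).2.trans_le hmono⟩
    · exact ⟨(ih h hm).1, (ih h hm).2.trans_le hmono⟩
    · refine ⟨by linarith [end_nonneg k, sum_nonneg k (i - 2 * height k)], ?_⟩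
      have hlt : i - 2 * height k + 1 ≤ 2 * height k + 1 := by
        simp only [height] at hi
        omega
      have := sum_mono hℓ k hlt
      simp only [rightEnd]
      linarith

/-- Different levels of one column are disjoint. -/
theorem level_unique (hlam : 0 < lam) (hℓ : ∀ k j, 0 < ℓ k j) {k i i' : ℕ} {x : ℝ}
    (hi : i < height k) (hi' : i' < height k) (hx : x ∈ level lam ℓ k i)
    (hx' : x ∈ level lam ℓ k i') : i = i' := by
  induction k generalizing i i' with
  | zero => simp only [height] at hi hi'; omega
  | succ k ih =>
    have hs : ∀ n, 0 ≤ ∑ j ∈ Finset.range n, ℓ k j := fun n =>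
      Finset.sum_nonneg fun j _ => (hℓ k j).le
    rcases mem_level_succ_cases hlam hℓ hx with ⟨h, hm, hc⟩ | ⟨j, h, e, hm, hc⟩ | ⟨h, ha, hb⟩ <;>
    rcases mem_level_succ_cases hlam hℓ hx' with
      ⟨h', hm', hc'⟩ | ⟨j', h', e', hm', hc'⟩ | ⟨h', ha', hb'⟩
    · exact ih h h' hm hm'
    · obtain rfl := ih h h' hm hm'
      linarith
    · linarith [(level_subset hlam hℓ h hm).2, hs (i' - 2 * height k)]
    · obtain rfl := ih h h' hm hm'
      linarith
    · rw [e, e', ih h h' hm hm']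
    · linarith [(level_subset hlam hℓ h hm).2, hs (i' - 2 * height k)]
    · linarith [(level_subset hlam hℓ h' hm').2, hs (i - 2 * height k)]
    · linarith [(level_subset hlam hℓ h' hm').2, hs (i - 2 * height k)]
    · rcases lt_trichotomy i i' with hlt | heq | hlt
      · linarith [sum_mono hℓ k (show i - 2 * height k + 1 ≤ i' - 2 * height k by omega)]
      · exact heq
      · linarith [sum_mono hℓ k (show i' - 2 * height k + 1 ≤ i - 2 * height k by omega)]

/-- The map of column `k + 1` extends the map of column `k`. -/
theorem columnMap_succ (hlam : 0 < lam) {k i : ℕ} {x : ℝ}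
    (hi : i + 1 < height k) (hx : x ∈ level lam ℓ k i) (hw : levelLength lam ℓ k i ≠ 0) :
    ∃ i', i' + 1 < height (k + 1) ∧ x ∈ level lam ℓ (k + 1) i' ∧
      columnMap lam ℓ (k + 1) i' x = columnMap lam ℓ k i x := by
  have hi0 : i < height k := by omega
  have h0 : (1 + lam) ≠ 0 := by positivity
  rcases mem_level_succ hlam hi0 hx with h | h
  · refine ⟨i, by simp only [height]; omega, h, ?_⟩
    simp only [columnMap, levelLength_left hi0, levelLeft_left hi0, levelLength_left hi,
      levelLeft_left hi]
    field_simp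
  · refine ⟨i + height k, by simp only [height]; omega, h, ?_⟩
    have e : i + height k + 1 = (i + 1) + height k := by omega
    simp only [columnMap, e, levelLength_right hi0, levelLeft_right hi0, levelLength_right hi,
      levelLeft_right hi]
    field_simp
    ring

/-- `realMap` agrees with each column map wherever the latter is defined. -/
theorem realMap_eq (hlam : 0 < lam) (hℓ : ∀ k j, 0 < ℓ k j) {k i : ℕ} {x : ℝ}
    (hi : i + 1 < height k) (hx : x ∈ level lam ℓ k i) :
    realMap lam ℓ x = columnMap lam ℓ k i x := by
  have up : ∀ (n k i : ℕ), i + 1 < height k → x ∈ level lam ℓ k i →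
      ∃ i', i' + 1 < height (k + n) ∧ x ∈ level lam ℓ (k + n) i' ∧
        columnMap lam ℓ (k + n) i' x = columnMap lam ℓ k i x := by
    intro n k i hi hx
    induction n with
    | zero => exact ⟨i, hi, hx, rfl⟩
    | succ n ih =>
      obtain ⟨i', h1, h2, h3⟩ := ih
      obtain ⟨i'', h4, h5, h6⟩ := columnMap_succ hlam h1 h2 (levelLength_pos hlam hℓ _ _).ne'
      exact ⟨i'', h4, h5, h6.trans h3⟩
  have h : ∃ p : ℕ × ℕ, p.2 + 1 < height p.1 ∧ x ∈ level lam ℓ p.1 p.2 := ⟨(k, i), hi, hx⟩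
  rw [realMap, dif_pos h]
  obtain ⟨h1, h2⟩ := h.choose_spec
  obtain ⟨a, ha1, ha2, ha3⟩ := up k _ _ h1 h2
  obtain ⟨b, hb1, hb2, hb3⟩ := up h.choose.1 _ _ hi hx
  rw [← ha3, ← hb3]
  rw [Nat.add_comm k] at hb1 hb2 ⊢
  have : a = b := level_unique hlam hℓ (by omega) (by omega) ha2 hb2
  rw [this]

end facts

/-- The nonsingular HK(+1, `lam`) transformation of the phase space. -/
noncomputable def map {lam : ℝ} (hlam : 0 < lam) {ℓ : ℕ → ℕ → ℝ} (hℓ : ∀ k j, 0 < ℓ k j) :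
    space lam ℓ → space lam ℓ :=
  (realMap_mapsTo hlam hℓ).restrict

/-- Nonsingular transformations, invertible on a set of full measure. -/
structure IsNonsingular {X : Type*} [MeasurableSpace X] (μ : Measure X) (S : X → X) : Prop where
  measurable : Measurable S
  null_iff : ∀ A, MeasurableSet A → (μ (S ⁻¹' A) = 0 ↔ μ A = 0)
  ae_invertible : ∃ R : X → X, Measurable R ∧ (∀ᵐ x ∂μ, R (S x) = x) ∧ ∀ᵐ x ∂μ, S (R x) = x

end HKTower

namespace HKTower

open ProbabilityTheory Set

/-! Everything is expressed through the proportion `levelProb` that a set occupies in a level. `S`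
is affine between consecutive levels, so it scales Lebesgue measure there by a constant, which
normalization removes: the proportion of `S⁻¹A` in a level is that of `A` in the next one
(`levelProb_preimage`). Cutting turns a proportion into a weighted mean with weights `1/(1+λ)` and
`λ/(1+λ)` (`levelProb_eq`).

Ergodicity: an invariant set has the same proportion in all levels, whereas a set of positive
measure nearly fills some level (`exists_levelProb_compl_lt`, a density argument). Hence an
invariant set and its complement cannot both have positive measure.

Isometric coefficients: `d(T φ(x), φ(x))` is invariant, hence a constant `c`. If `φ` is close to `y`
on most of a level of column `k`, it is so on most of both pieces of it. Since `S^{h_k}` carries the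
left piece onto the right one, `T^{h_k}` nearly fixes `y`. One cut later the same holds for
`T^{h_{k+1}}`. As `h_{k+1} = 4h_k + 1`, `T` itself nearly fixes `y`. This forces `c = 0`, so `φ` is
invariant, and ergodicity makes it constant. -/

/-- The `i`-th level of column `k`, as a subset of the phase space. -/
def levelSet (lam : ℝ) (ℓ : ℕ → ℕ → ℝ) (k i : ℕ) : Set (space lam ℓ) :=
  Subtype.val ⁻¹' level lam ℓ k i

/-- The normalized Lebesgue measure on the `i`-th level of column `k`. -/
noncomputable def levelProb (lam : ℝ) (ℓ : ℕ → ℕ → ℝ) (k i : ℕ) : Measure (space lam ℓ) :=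
  cond (measure lam ℓ) (levelSet lam ℓ k i)

/-! ### Proportions in levels, under cutting and under the map. -/

section levels

variable {lam : ℝ} {ℓ : ℕ → ℕ → ℝ}

theorem height_succ (k : ℕ) : height (k + 1) = 4 * height k + 1 := by
  simp only [height]
  omega

theorem measurableSet_level (k i : ℕ) : MeasurableSet (level lam ℓ k i) := measurableSet_Ico

theorem level_subset_space {k i : ℕ} (hi : i < height k) : level lam ℓ k i ⊆ space lam ℓ :=
  fun _ hx => ⟨k, i, hi, hx⟩

theorem zero_mem_space : (0 : ℝ) ∈ space lam ℓ :=
  ⟨0, 0, by simp [height], by simp [level, levelLeft, levelLength]⟩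

theorem measurableSet_space : MeasurableSet (space lam ℓ) := by
  have : space lam ℓ = ⋃ k, ⋃ i, ⋃ _ : i < height k, level lam ℓ k i := by
    ext x
    simp [space]
  rw [this]
  exact .iUnion fun k => .iUnion fun i => .iUnion fun _ => measurableSet_level k i

theorem measurableSet_levelSet (k i : ℕ) : MeasurableSet (levelSet lam ℓ k i) :=
  measurable_subtype_coe (measurableSet_level k i)

theorem measure_apply (A : Set (space lam ℓ)) :
    measure lam ℓ A = volume (Subtype.val '' A : Set ℝ) :=
  comap_subtype_coe_apply measurableSet_space volume A

theorem measure_levelSet {k i : ℕ} (hi : i < height k) :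
    measure lam ℓ (levelSet lam ℓ k i) = ENNReal.ofReal (levelLength lam ℓ k i) := by
  rw [measure_apply, levelSet, Subtype.image_preimage_coe,
    inter_eq_right.mpr (level_subset_space hi), level, Real.volume_Ico]
  congr 1
  ring

theorem measure_levelSet_ne_zero (hlam : 0 < lam) (hℓ : ∀ k j, 0 < ℓ k j) {k i : ℕ}
    (hi : i < height k) : measure lam ℓ (levelSet lam ℓ k i) ≠ 0 := by
  rw [measure_levelSet hi]
  simpa using levelLength_pos hlam hℓ k i

theorem measure_levelSet_ne_top {k i : ℕ} (hi : i < height k) :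
    measure lam ℓ (levelSet lam ℓ k i) ≠ ⊤ := by
  rw [measure_levelSet hi]
  exact ENNReal.ofReal_ne_top

theorem isProbabilityMeasure_levelProb (hlam : 0 < lam) (hℓ : ∀ k j, 0 < ℓ k j) {k i : ℕ}
    (hi : i < height k) : IsProbabilityMeasure (levelProb lam ℓ k i) :=
  cond_isProbabilityMeasure_of_finite (measure_levelSet_ne_zero hlam hℓ hi)
    (measure_levelSet_ne_top hi)

theorem levelProb_apply (k i : ℕ) (A : Set (space lam ℓ)) :
    levelProb lam ℓ k i A =
      (measure lam ℓ (levelSet lam ℓ k i))⁻¹ * measure lam ℓ (levelSet lam ℓ k i ∩ A) :=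
  cond_apply (measurableSet_levelSet k i) _ A

theorem levelProb_absolutelyContinuous (k i : ℕ) :
    levelProb lam ℓ k i ≪ measure lam ℓ :=
  cond_absolutelyContinuous

theorem measure_levelSet_inter (hlam : 0 < lam) (hℓ : ∀ k j, 0 < ℓ k j) {k i : ℕ}
    (hi : i < height k) (A : Set (space lam ℓ)) :
    measure lam ℓ (levelSet lam ℓ k i ∩ A) =
      ENNReal.ofReal (levelLength lam ℓ k i) * levelProb lam ℓ k i A := by
  rw [levelProb_apply, ← measure_levelSet hi, ← mul_assoc,
    ENNReal.mul_inv_cancel (measure_levelSet_ne_zero hlam hℓ hi) (measure_levelSet_ne_top hi),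
    one_mul]

/-- A level is the disjoint union of its two pieces. -/
theorem level_eq_union (hlam : 0 < lam) (hℓ : ∀ k j, 0 < ℓ k j) {k i : ℕ} (hi : i < height k) :
    level lam ℓ k i = level lam ℓ (k + 1) i ∪ level lam ℓ (k + 1) (i + height k) := by
  refine Subset.antisymm (fun x hx => mem_level_succ hlam hi hx) ?_
  rintro x (hx | hx)
  · rcases mem_level_succ_cases hlam hℓ hx with ⟨_, h, _⟩ | ⟨j, _, h, _, _⟩ | ⟨h, _, _⟩
    · exact h
    · omega
    · omega
  · rcases mem_level_succ_cases hlam hℓ hx with ⟨h, _, _⟩ | ⟨j, _, h, h', _⟩ | ⟨h, _, _⟩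
    · omega
    · obtain rfl : i = j := by omega
      exact h'
    · omega

theorem levelSet_eq_union (hlam : 0 < lam) (hℓ : ∀ k j, 0 < ℓ k j) {k i : ℕ}
    (hi : i < height k) :
    levelSet lam ℓ k i = levelSet lam ℓ (k + 1) i ∪ levelSet lam ℓ (k + 1) (i + height k) := by
  rw [levelSet, level_eq_union hlam hℓ hi, preimage_union, levelSet, levelSet]

theorem disjoint_levelSet (hlam : 0 < lam) (hℓ : ∀ k j, 0 < ℓ k j) {k i j : ℕ}
    (hi : i < height k) (hj : j < height k) (h : i ≠ j) :
    Disjoint (levelSet lam ℓ k i) (levelSet lam ℓ k j) :=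
  Set.disjoint_left.mpr fun _ hx hx' => h (level_unique hlam hℓ hi hj hx hx')

/-- The proportion of a set in a level is the weighted mean of its proportions in the pieces. -/
theorem levelProb_eq (hlam : 0 < lam) (hℓ : ∀ k j, 0 < ℓ k j) {k i : ℕ}
    (hi : i < height k) {A : Set (space lam ℓ)} (hA : MeasurableSet A) :
    levelProb lam ℓ k i A =
      ENNReal.ofReal (1 / (1 + lam)) * levelProb lam ℓ (k + 1) i A +
        ENNReal.ofReal (lam / (1 + lam)) * levelProb lam ℓ (k + 1) (i + height k) A := by
  have hi1 : i < height (k + 1) := by rw [height_succ]; omega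
  have hi2 : i + height k < height (k + 1) := by rw [height_succ]; omega
  have hw := levelLength_pos hlam hℓ k i
  have h0 : ENNReal.ofReal (levelLength lam ℓ k i) ≠ 0 := by simpa using hw
  refine (ENNReal.mul_right_inj h0 ENNReal.ofReal_ne_top).mp ?_
  rw [← measure_levelSet_inter hlam hℓ hi, levelSet_eq_union hlam hℓ hi, union_inter_distrib_right,
    measure_union' ?_ ?_, measure_levelSet_inter hlam hℓ hi1, measure_levelSet_inter hlam hℓ hi2,
    levelLength_left hi, levelLength_right hi, mul_add, ← mul_assoc, ← mul_assoc,
    ← ENNReal.ofReal_mul hw.le, ← ENNReal.ofReal_mul hw.le]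
  · congr 3 <;> ring_nf
  · exact disjoint_levelSet hlam hℓ hi1 hi2 (by have := height_pos k; omega) |>.mono
      inter_subset_left inter_subset_left
  · exact (measurableSet_levelSet _ _).inter hA

/-- Each cut multiplies lengths by `1/(1+λ)` or `λ/(1+λ)`, at most `max 1 λ / (1+λ) < 1`. -/
theorem exists_mem_levelSet_add (hlam : 0 < lam) (hℓ : ∀ k j, 0 < ℓ k j) {k i : ℕ}
    (hi : i < height k) {x : space lam ℓ} (hx : x ∈ levelSet lam ℓ k i) (n : ℕ) :
    ∃ j < height (k + n), x ∈ levelSet lam ℓ (k + n) j ∧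
      levelLength lam ℓ (k + n) j ≤ (max 1 lam / (1 + lam)) ^ n * levelLength lam ℓ k i := by
  induction n with
  | zero => exact ⟨i, hi, hx, by simp⟩
  | succ n ih =>
    obtain ⟨j, hj, hxj, hl⟩ := ih
    have hw := (levelLength_pos hlam hℓ (k + n) j).le
    have step : max 1 lam / (1 + lam) * levelLength lam ℓ (k + n) j ≤
        (max 1 lam / (1 + lam)) ^ (n + 1) * levelLength lam ℓ k i := by
      rw [pow_succ', mul_assoc]
      gcongr
    rcases mem_level_succ hlam hj hxj with h | h
    · refine ⟨j, by rw [← add_assoc, height_succ]; omega, h, le_trans ?_ step⟩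
      rw [← add_assoc, levelLength_left hj, div_mul_eq_mul_div]
      gcongr
      exact le_mul_of_one_le_left hw (le_max_left _ _)
    · refine ⟨j + height (k + n), by rw [← add_assoc, height_succ]; omega, h, le_trans ?_ step⟩
      rw [← add_assoc, levelLength_right hj, div_mul_eq_mul_div]
      gcongr
      exact le_max_right _ _

/-- Each point of the phase space lies in levels of arbitrarily small length. -/
theorem exists_mem_levelSet (hlam : 0 < lam) (hℓ : ∀ k j, 0 < ℓ k j)
    (x : space lam ℓ) {ε : ℝ} (hε : 0 < ε) :
    ∃ k, ∃ i < height k, x ∈ levelSet lam ℓ k i ∧ levelLength lam ℓ k i < ε := by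
  obtain ⟨k, i, hi, hx⟩ := x.2
  have hr : max 1 lam / (1 + lam) < 1 := by
    rw [div_lt_one (by linarith)]
    exact max_lt (by linarith) (by linarith)
  have ht := (tendsto_pow_atTop_nhds_zero_of_lt_one (by positivity) hr).mul_const
    (levelLength lam ℓ k i)
  rw [zero_mul] at ht
  obtain ⟨n, hn⟩ := (ht.eventually_lt_const hε).exists
  obtain ⟨j, hj, hxj, hl⟩ := exists_mem_levelSet_add hlam hℓ hi hx n
  exact ⟨k + n, j, hj, hxj, hl.trans_lt hn⟩

/-- `columnMap` is an affine bijection between the two levels, and its constant Jacobian is the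
ratio of their lengths, which cancels on normalizing. -/
theorem levelProb_preimage (hlam : 0 < lam) (hℓ : ∀ k j, 0 < ℓ k j) {k i : ℕ}
    (hi : i + 1 < height k) (A : Set (space lam ℓ)) :
    levelProb lam ℓ k i (map hlam hℓ ⁻¹' A) = levelProb lam ℓ k (i + 1) A := by
  have hi0 : i < height k := by omega
  have h1 := levelLength_pos hlam hℓ k i
  have h2 := levelLength_pos hlam hℓ k (i + 1)
  have key : (Subtype.val '' (levelSet lam ℓ k i ∩ map hlam hℓ ⁻¹' A) : Set ℝ) =
      columnMap lam ℓ k i ⁻¹' (Subtype.val '' (levelSet lam ℓ k (i + 1) ∩ A)) := by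
    ext x
    constructor
    · rintro ⟨y, ⟨hy, hyA⟩, rfl⟩
      have e : (map hlam hℓ y : ℝ) = columnMap lam ℓ k i y := realMap_eq hlam hℓ hi hy
      exact ⟨map hlam hℓ y, ⟨by rw [levelSet, mem_preimage, e]; exact columnMap_mem hlam hℓ hy,
        hyA⟩, e⟩
    · rintro ⟨y, ⟨hy, hyA⟩, hyx⟩
      have hx : x ∈ level lam ℓ k i := by
        have hy' : (y : ℝ) ∈ level lam ℓ k (i + 1) := hy
        rw [hyx, columnMap, level, mem_Ico] at hy'
        obtain ⟨ha, hb⟩ := hy'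
        have hc : 0 < levelLength lam ℓ k (i + 1) / levelLength lam ℓ k i := div_pos h2 h1
        constructor
        · have := nonneg_of_mul_nonneg_left (show 0 ≤ (x - levelLeft lam ℓ k i) *
            (levelLength lam ℓ k (i + 1) / levelLength lam ℓ k i) by linarith) hc
          linarith
        · have := lt_of_mul_lt_mul_right (show (x - levelLeft lam ℓ k i) *
            (levelLength lam ℓ k (i + 1) / levelLength lam ℓ k i) < levelLength lam ℓ k i *
            (levelLength lam ℓ k (i + 1) / levelLength lam ℓ k i) by
              rw [mul_div_cancel₀ _ h1.ne']; linarith) hc.le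
          linarith
      have e : (map hlam hℓ ⟨x, level_subset_space hi0 hx⟩ : ℝ) = columnMap lam ℓ k i x :=
        realMap_eq hlam hℓ hi hx
      refine ⟨⟨x, level_subset_space hi0 hx⟩, ⟨hx, ?_⟩, rfl⟩
      have : map hlam hℓ ⟨x, level_subset_space hi0 hx⟩ = y := Subtype.ext (e.trans hyx.symm)
      rwa [mem_preimage, this]
  have hvol (s : Set ℝ) : volume (columnMap lam ℓ k i ⁻¹' s) =
      ENNReal.ofReal (levelLength lam ℓ k i / levelLength lam ℓ k (i + 1)) * volume s := by
    set c := levelLength lam ℓ k (i + 1) / levelLength lam ℓ k i with hc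
    have hc0 : 0 < c := div_pos h2 h1
    have : columnMap lam ℓ k i ⁻¹' s = (fun x => c * x) ⁻¹'
        ((fun x => (levelLeft lam ℓ k (i + 1) - levelLeft lam ℓ k i * c) + x) ⁻¹' s) := by
      ext x
      simp only [mem_preimage, columnMap, ← hc]
      ring_nf
    rw [this, Real.volume_preimage_mul_left hc0.ne', measure_preimage_add,
      abs_of_pos (inv_pos.mpr hc0), hc, inv_div]
  rw [levelProb_apply, levelProb_apply, measure_apply (_ ∩ _), key, hvol, ← measure_apply,
    measure_levelSet hi0, measure_levelSet hi, ENNReal.ofReal_div_of_pos h2, ← mul_assoc,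
    div_eq_mul_inv, ← mul_assoc, ENNReal.inv_mul_cancel (by simpa using h1) ENNReal.ofReal_ne_top,
    one_mul]

theorem levelProb_preimage_iterate (hlam : 0 < lam) (hℓ : ∀ k j, 0 < ℓ k j) {k i n : ℕ}
    (hi : i + n < height k) (A : Set (space lam ℓ)) :
    levelProb lam ℓ k i ((map hlam hℓ)^[n] ⁻¹' A) = levelProb lam ℓ k (i + n) A := by
  induction n generalizing A with
  | zero => rfl
  | succ n ih =>
    rw [Function.iterate_succ', preimage_comp, ih (by omega),
      levelProb_preimage hlam hℓ (by omega), add_assoc]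

end levels

/-! ### Nonsingularity and almost everywhere invertibility. -/

section nonsingular

variable {lam : ℝ} {ℓ : ℕ → ℕ → ℝ}

theorem levelLeft_zero (k : ℕ) : levelLeft lam ℓ k 0 = 0 := by
  induction k with
  | zero => rfl
  | succ k ih => rw [levelLeft_left (height_pos k), ih]

/-- The only point which lies in no level but bottom ones is the origin. -/
theorem exists_mem_levelSet_succ (hlam : 0 < lam) (hℓ : ∀ k j, 0 < ℓ k j) {x : space lam ℓ}
    (hx : (x : ℝ) ≠ 0) : ∃ k i, i + 1 < height k ∧ x ∈ levelSet lam ℓ k (i + 1) := by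
  have hx0 : 0 < (x : ℝ) := by
    obtain ⟨k, i, hi, h⟩ := x.2
    exact lt_of_le_of_ne (level_subset hlam hℓ hi h).1 hx.symm
  -- Bottom levels start at the origin, so one shorter than `x` does not contain `x`.
  obtain ⟨k, i, hi, h, hl⟩ := exists_mem_levelSet hlam hℓ x hx0
  cases i with
  | zero =>
    have h2 : (x : ℝ) < levelLeft lam ℓ k 0 + levelLength lam ℓ k 0 := h.2
    rw [levelLeft_zero] at h2
    linarith
  | succ i => exact ⟨k, i, hi, h⟩

theorem measure_singleton_eq_zero (x : space lam ℓ) : measure lam ℓ {x} = 0 := by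
  rw [measure_apply, image_singleton, Real.volume_singleton]

theorem measure_levelSet_inter_eq_zero_iff {k i : ℕ} (hi : i < height k) (A : Set (space lam ℓ)) :
    measure lam ℓ (levelSet lam ℓ k i ∩ A) = 0 ↔ levelProb lam ℓ k i A = 0 := by
  rw [levelProb_apply, mul_eq_zero, or_iff_right]
  exact ENNReal.inv_ne_zero.mpr (measure_levelSet_ne_top hi)

theorem measure_eq_zero_of_forall_not_top (hlam : 0 < lam) {A : Set (space lam ℓ)}
    (h : ∀ k i, i + 1 < height k → levelProb lam ℓ k i A = 0) : measure lam ℓ A = 0 := by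
  refine measure_mono_null (t := ⋃ k, ⋃ i, ⋃ _ : i + 1 < height k, levelSet lam ℓ k i ∩ A) ?_ ?_
  · intro x hx
    obtain ⟨⟨k, i⟩, hi, hm⟩ := exists_not_top hlam x.2
    exact mem_iUnion.mpr ⟨k, mem_iUnion.mpr ⟨i, mem_iUnion.mpr ⟨hi, hm, hx⟩⟩⟩
  · simp only [measure_iUnion_null_iff]
    exact fun k i hi => (measure_levelSet_inter_eq_zero_iff (by omega) A).mpr (h k i hi)

theorem measure_eq_zero_of_forall_not_bottom (hlam : 0 < lam) (hℓ : ∀ k j, 0 < ℓ k j)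
    {A : Set (space lam ℓ)}
    (h : ∀ k i, i + 1 < height k → levelProb lam ℓ k (i + 1) A = 0) : measure lam ℓ A = 0 := by
  have h0 : measure lam ℓ (⋃ k, ⋃ i, ⋃ _ : i + 1 < height k, levelSet lam ℓ k (i + 1) ∩ A) = 0 := by
    simp only [measure_iUnion_null_iff]
    exact fun k i hi => (measure_levelSet_inter_eq_zero_iff hi A).mpr (h k i hi)
  refine measure_mono_null ?_ (measure_union_null
    (measure_singleton_eq_zero ⟨0, zero_mem_space⟩) h0)
  intro x hx
  by_cases hx0 : (x : ℝ) = 0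
  · exact Or.inl (Subtype.ext hx0)
  · obtain ⟨k, i, hi, hm⟩ := exists_mem_levelSet_succ hlam hℓ hx0
    exact Or.inr (mem_iUnion.mpr ⟨k, mem_iUnion.mpr ⟨i, mem_iUnion.mpr ⟨hi, hm, hx⟩⟩⟩)

/-- The levels below the top cover the space, and their images, the levels above the bottom, cover
it up to the origin. Null sets can thus be tested on either family, and `levelProb_preimage` matches
the two. -/
theorem measure_preimage_map_eq_zero_iff (hlam : 0 < lam) (hℓ : ∀ k j, 0 < ℓ k j)
    (A : Set (space lam ℓ)) :
    measure lam ℓ (map hlam hℓ ⁻¹' A) = 0 ↔ measure lam ℓ A = 0 := by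
  constructor <;> intro h
  · refine measure_eq_zero_of_forall_not_bottom hlam hℓ fun k i hi => ?_
    rw [← levelProb_preimage hlam hℓ hi]
    exact levelProb_absolutelyContinuous k i h
  · refine measure_eq_zero_of_forall_not_top hlam fun k i hi => ?_
    rw [levelProb_preimage hlam hℓ hi]
    exact levelProb_absolutelyContinuous k (i + 1) h

theorem measurable_columnMap (k i : ℕ) : Measurable (columnMap lam ℓ k i) := by
  unfold columnMap
  fun_prop

theorem measurable_map (hlam : 0 < lam) (hℓ : ∀ k j, 0 < ℓ k j) : Measurable (map hlam hℓ) := by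
  intro A hA
  obtain ⟨B, hB, rfl⟩ := hA
  have : map hlam hℓ ⁻¹' (Subtype.val ⁻¹' B) = ⋃ k, ⋃ i, ⋃ _ : i + 1 < height k,
      levelSet lam ℓ k i ∩ Subtype.val ⁻¹' (columnMap lam ℓ k i ⁻¹' B) := by
    ext x
    simp only [mem_iUnion, mem_inter_iff, mem_preimage]
    constructor
    · intro hx
      obtain ⟨⟨k, i⟩, hi, hm⟩ := exists_not_top hlam x.2
      refine ⟨k, i, hi, hm, ?_⟩
      rwa [← realMap_eq hlam hℓ hi hm]
    · rintro ⟨k, i, hi, hm, hx⟩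
      rwa [← realMap_eq hlam hℓ hi hm] at hx
  rw [this]
  exact .iUnion fun k => .iUnion fun i => .iUnion fun _ => (measurableSet_levelSet k i).inter
    (measurable_subtype_coe (measurable_columnMap k i hB))

/-- Lets two points be compared within one common column, below its top. -/
theorem exists_mem_levelSet_not_top_add (hlam : 0 < lam) {k i : ℕ} (hi : i + 1 < height k)
    {x : space lam ℓ} (hx : x ∈ levelSet lam ℓ k i) (n : ℕ) :
    ∃ j, j + 1 < height (k + n) ∧ x ∈ levelSet lam ℓ (k + n) j := by
  induction n with
  | zero => exact ⟨i, hi, hx⟩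
  | succ n ih =>
    obtain ⟨j, hj, hxj⟩ := ih
    rcases mem_level_succ hlam (by omega) hxj with h | h
    · exact ⟨j, by rw [← add_assoc, height_succ]; omega, h⟩
    · exact ⟨j + height (k + n), by rw [← add_assoc, height_succ]; omega, h⟩

theorem injective_map (hlam : 0 < lam) (hℓ : ∀ k j, 0 < ℓ k j) :
    Function.Injective (map hlam hℓ) := by
  intro x y hxy
  obtain ⟨⟨k, i⟩, hi, hx⟩ := exists_not_top hlam x.2
  obtain ⟨⟨m, j⟩, hj, hy⟩ := exists_not_top hlam y.2
  obtain ⟨a, ha, hxa⟩ := exists_mem_levelSet_not_top_add hlam hi hx m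
  obtain ⟨b, hb, hyb⟩ := exists_mem_levelSet_not_top_add hlam hj hy k
  dsimp only at ha hxa hb hyb
  rw [add_comm m k] at hb hyb
  have e : columnMap lam ℓ (k + m) a x = columnMap lam ℓ (k + m) b y := by
    rw [← realMap_eq hlam hℓ ha hxa, ← realMap_eq hlam hℓ hb hyb]
    exact congrArg Subtype.val hxy
  -- The common image lies in levels `a + 1` and `b + 1` of the same column.
  obtain rfl : a = b := Nat.succ_injective <| level_unique hlam hℓ ha hb
    (columnMap_mem hlam hℓ hxa) (e ▸ columnMap_mem hlam hℓ hyb)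
  have hc := div_pos (levelLength_pos hlam hℓ (k + m) (a + 1)) (levelLength_pos hlam hℓ (k + m) a)
  have := mul_right_cancel₀ hc.ne' (add_left_cancel e)
  exact Subtype.ext (sub_left_injective this)

theorem mem_range_map (hlam : 0 < lam) (hℓ : ∀ k j, 0 < ℓ k j) {x : space lam ℓ}
    (hx : (x : ℝ) ≠ 0) : x ∈ range (map hlam hℓ) := by
  obtain ⟨k, i, hi, hm⟩ := exists_mem_levelSet_succ hlam hℓ hx
  have h1 := levelLength_pos hlam hℓ k i
  have h2 := levelLength_pos hlam hℓ k (i + 1)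
  set y := levelLeft lam ℓ k i + (x - levelLeft lam ℓ k (i + 1)) *
    (levelLength lam ℓ k i / levelLength lam ℓ k (i + 1)) with hy
  have hc : 0 < levelLength lam ℓ k i / levelLength lam ℓ k (i + 1) := div_pos h1 h2
  have hyl : y ∈ level lam ℓ k i := by
    obtain ⟨ha, hb⟩ : levelLeft lam ℓ k (i + 1) ≤ x ∧
      (x : ℝ) < levelLeft lam ℓ k (i + 1) + levelLength lam ℓ k (i + 1) := hm
    constructor
    · have := mul_nonneg (sub_nonneg.mpr ha) hc.le
      linarith
    · have := mul_lt_mul_of_pos_right (sub_lt_iff_lt_add'.mpr hb) hc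
      rw [mul_div_cancel₀ _ h2.ne'] at this
      linarith
  refine ⟨⟨y, level_subset_space (by omega) hyl⟩, Subtype.ext ?_⟩
  refine (realMap_eq hlam hℓ hi hyl).trans ?_
  rw [columnMap, hy]
  field_simp
  ring

theorem isNonsingular_map (hlam : 0 < lam) (hℓ : ∀ k j, 0 < ℓ k j) :
    IsNonsingular (measure lam ℓ) (map hlam hℓ) where
  measurable := measurable_map hlam hℓ
  null_iff A _ := measure_preimage_map_eq_zero_iff hlam hℓ A
  ae_invertible := by
    have : StandardBorelSpace (space lam ℓ) := measurableSet_space.standardBorel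
    have : Nonempty (space lam ℓ) := ⟨⟨0, zero_mem_space⟩⟩
    -- Lusin–Souslin: an injective Borel map between standard Borel spaces has a measurable inverse
    -- on its image, which here misses at most the origin.
    have hS := (measurable_map hlam hℓ).measurableEmbedding (injective_map hlam hℓ)
    refine ⟨hS.invFun, hS.measurable_invFun, .of_forall hS.leftInverse_invFun, ?_⟩
    refine measure_mono_null (fun x hx => ?_) (measure_singleton_eq_zero ⟨0, zero_mem_space⟩)
    by_contra hne
    obtain ⟨y, rfl⟩ := mem_range_map hlam hℓ (x := x) fun h => hne (Subtype.ext h)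
    exact hx (congrArg _ (hS.leftInverse_invFun y))

end nonsingular
-- Density of levels and ergodicity.
section ergodic

variable {lam : ℝ} {ℓ : ℕ → ℕ → ℝ}

/-- A lower bound for the proportion of a set in all levels holds for all open sets. -/
theorem mul_measure_le_of_isOpen (hlam : 0 < lam) (hℓ : ∀ k j, 0 < ℓ k j)
    {B : Set (space lam ℓ)} (hB : MeasurableSet B) {δ : ENNReal}
    (h : ∀ k, ∀ i < height k, δ ≤ levelProb lam ℓ k i B) {V : Set (space lam ℓ)} (hV : IsOpen V) :
    δ * measure lam ℓ V ≤ measure lam ℓ (V ∩ B) := by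
  classical
  -- The levels of column `k` inside `V` have union `W k`, which increases to `V` because levels
  -- shrink around every point.
  set J : ℕ → Finset ℕ := fun k => (Finset.range (height k)).filter fun i => levelSet lam ℓ k i ⊆ V
  set W : ℕ → Set (space lam ℓ) := fun k => ⋃ i ∈ J k, levelSet lam ℓ k i
  have hJ {k i : ℕ} : i ∈ J k ↔ i < height k ∧ levelSet lam ℓ k i ⊆ V := by simp [J]
  have hmono : Monotone W := by
    refine monotone_nat_of_le_succ fun k x hx => ?_
    obtain ⟨i, hi, hx⟩ := mem_iUnion₂.mp hx
    obtain ⟨hi, hiV⟩ := hJ.mp hi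
    rw [levelSet_eq_union hlam hℓ hi] at hx hiV
    rcases hx with hx | hx
    · exact mem_iUnion₂.mpr ⟨i, hJ.mpr ⟨by rw [height_succ]; omega,
        subset_union_left.trans hiV⟩, hx⟩
    · exact mem_iUnion₂.mpr ⟨i + height k, hJ.mpr ⟨by rw [height_succ]; omega,
        subset_union_right.trans hiV⟩, hx⟩
  have hWV : V = ⋃ k, W k := by
    refine Subset.antisymm (fun x hx => ?_) (iUnion_subset fun k => iUnion₂_subset fun i hi =>
      (hJ.mp hi).2)
    obtain ⟨ε, hε, hball⟩ := Metric.isOpen_iff.mp hV x hx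
    obtain ⟨k, i, hi, hm, hl⟩ := exists_mem_levelSet hlam hℓ x hε
    refine mem_iUnion.mpr ⟨k, mem_iUnion₂.mpr ⟨i, hJ.mpr ⟨hi, fun y hy => hball ?_⟩, hm⟩⟩
    have h1 : (x : ℝ) ∈ Ico _ _ := hm
    have h2 : (y : ℝ) ∈ Ico _ _ := hy
    rw [Metric.mem_ball, Subtype.dist_eq, Real.dist_eq, abs_lt]
    constructor <;> linarith [h1.1, h1.2, h2.1, h2.2]
  have hW (k : ℕ) : δ * measure lam ℓ (W k) ≤ measure lam ℓ (V ∩ B) := by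
    have hd : (J k : Set ℕ).PairwiseDisjoint (levelSet lam ℓ k) := fun i hi j hj hij =>
      disjoint_levelSet hlam hℓ (hJ.mp hi).1 (hJ.mp hj).1 hij
    calc δ * measure lam ℓ (W k)
        = ∑ i ∈ J k, δ * measure lam ℓ (levelSet lam ℓ k i) := by
          rw [measure_biUnion_finset hd fun i _ => measurableSet_levelSet k i, Finset.mul_sum]
      _ ≤ ∑ i ∈ J k, (measure lam ℓ).restrict B (levelSet lam ℓ k i) := by
          refine Finset.sum_le_sum fun i hi => ?_
          have hi := (hJ.mp hi).1
          rw [Measure.restrict_apply (measurableSet_levelSet k i),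
            measure_levelSet_inter hlam hℓ hi, measure_levelSet hi, mul_comm]
          gcongr
          exact h k i hi
      _ = (measure lam ℓ).restrict B (W k) :=
          (measure_biUnion_finset hd fun i _ => measurableSet_levelSet k i).symm
      _ ≤ (measure lam ℓ).restrict B V := measure_mono (hWV ▸ subset_iUnion W k)
      _ = measure lam ℓ (V ∩ B) := Measure.restrict_apply' hB
  calc δ * measure lam ℓ V = ⨆ k, δ * measure lam ℓ (W k) := by
        rw [hWV, hmono.measure_iUnion, ENNReal.mul_iSup]
    _ ≤ _ := iSup_le hW

/-- A set of positive measure nearly fills some level. -/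
theorem exists_levelProb_compl_lt (hlam : 0 < lam) (hℓ : ∀ k j, 0 < ℓ k j)
    {A : Set (space lam ℓ)} (hA : MeasurableSet A) (h0 : measure lam ℓ A ≠ 0) {δ : ENNReal}
    (hδ : δ ≠ 0) : ∃ k, ∃ i < height k, levelProb lam ℓ k i Aᶜ < δ := by
  -- The space may have infinite measure; `A` is then replaced by its part in a single level.
  wlog hfin : measure lam ℓ A ≠ ⊤ generalizing A
  · obtain ⟨k, i, hi, hp⟩ : ∃ k i, i + 1 < height k ∧ levelProb lam ℓ k i A ≠ 0 := by
      by_contra! H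
      exact h0 (measure_eq_zero_of_forall_not_top hlam H)
    obtain ⟨m, j, hj, hlt⟩ := this ((measurableSet_levelSet k i).inter hA)
      (mt (measure_levelSet_inter_eq_zero_iff (by omega) A).mp hp)
      (measure_ne_top_of_subset inter_subset_left (measure_levelSet_ne_top (by omega)))
    exact ⟨m, j, hj, (measure_mono (compl_subset_compl.mpr inter_subset_right)).trans_lt hlt⟩
  by_contra! H
  have hpos : δ * measure lam ℓ A ≠ 0 := mul_ne_zero hδ h0
  -- Outer regularity gives an open set exceeding `A` by less than `δ μ(A)`, while under `H` the
  -- complement of `A` takes up at least `δ μ(V) ≥ δ μ(A)` of it.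
  obtain ⟨U, hAU, hU, hlt⟩ := Set.exists_isOpen_lt_add (μ := volume) (Subtype.val '' A : Set ℝ)
    (by rwa [← measure_apply]) hpos
  set V : Set (space lam ℓ) := Subtype.val ⁻¹' U
  have hAV : A ⊆ V := image_subset_iff.mp hAU
  have h1 : measure lam ℓ V ≤ volume U := by
    rw [measure_apply]
    exact measure_mono (image_preimage_subset _ _)
  have h2 := mul_measure_le_of_isOpen hlam hℓ hA.compl H
    (hU.preimage continuous_subtype_val : IsOpen V)
  have h3 : measure lam ℓ A + δ * measure lam ℓ A ≤ measure lam ℓ V := by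
    rw [← measure_inter_add_sdiff V hA, inter_eq_right.mpr hAV]
    gcongr
    exact (mul_le_mul_right (measure_mono hAV) δ).trans h2
  rw [← measure_apply] at hlt
  exact (h3.trans h1).not_gt hlt

/-- An invariant set has the same proportion in all levels. -/
theorem levelProb_eq_of_preimage_eq (hlam : 0 < lam) (hℓ : ∀ k j, 0 < ℓ k j)
    {A : Set (space lam ℓ)} (hA : MeasurableSet A) (hinv : map hlam hℓ ⁻¹' A = A) {k i : ℕ}
    (hi : i < height k) : levelProb lam ℓ k i A = levelProb lam ℓ 0 0 A := by
  have hrow {k i : ℕ} (hi : i < height k) : levelProb lam ℓ k i A = levelProb lam ℓ k 0 A := by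
    have := levelProb_preimage_iterate hlam hℓ (k := k) (i := 0) (n := i) (by omega) A
    rwa [zero_add, Set.preimage_iterate_eq, Function.iterate_fixed hinv, eq_comm] at this
  rw [hrow hi]
  clear hi i
  induction k with
  | zero => rfl
  | succ k ih =>
    -- By `hrow` both pieces of the bottom level have the same proportion, and their weights add up
    -- to one.
    rw [← ih, levelProb_eq hlam hℓ (height_pos k) hA,
      hrow (show 0 + height k < height (k + 1) by rw [height_succ]; omega), ← add_mul,
      ← ENNReal.ofReal_add (by positivity) (by positivity), ← add_div, div_self (by positivity),
      ENNReal.ofReal_one, one_mul]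

theorem quasiErgodic_map (hlam : 0 < lam) (hℓ : ∀ k j, 0 < ℓ k j) :
    QuasiErgodic (map hlam hℓ) (measure lam ℓ) where
  measurable := measurable_map hlam hℓ
  absolutelyContinuous := by
    refine Measure.AbsolutelyContinuous.mk fun A hA h => ?_
    rw [Measure.map_apply (measurable_map hlam hℓ) hA]
    exact (measure_preimage_map_eq_zero_iff hlam hℓ A).mpr h
  aeconst_set A hA hinv := by
    rw [Filter.eventuallyConst_set']
    by_contra! H
    obtain ⟨h1, h2⟩ := H
    rw [ae_eq_empty] at h1
    rw [ae_eq_univ] at h2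
    obtain ⟨k, i, hi, h3⟩ := exists_levelProb_compl_lt hlam hℓ hA h1 (δ := 2⁻¹) (by simp)
    obtain ⟨m, j, hj, h4⟩ := exists_levelProb_compl_lt hlam hℓ hA.compl h2 (δ := 2⁻¹) (by simp)
    rw [levelProb_eq_of_preimage_eq hlam hℓ hA.compl (by rw [preimage_compl, hinv]) hi] at h3
    rw [compl_compl, levelProb_eq_of_preimage_eq hlam hℓ hA hinv hj] at h4
    have := isProbabilityMeasure_levelProb hlam hℓ (height_pos 0)
    -- The proportions of `A` and of its complement in the level `[0,1)` are both below one half,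
    -- yet add up to one.
    have h5 := ENNReal.add_lt_add h4 h3
    rw [prob_add_prob_compl hA, ENNReal.inv_two_add_inv_two] at h5
    exact h5.false

/-- As `λ ≤ 1`, both pieces have weight at least `λ/(1+λ)`, so a cut enlarges a small proportion at
most by the inverse factor. -/
theorem levelProb_succ_lt (hlam : 0 < lam) (hlam1 : lam ≤ 1) (hℓ : ∀ k j, 0 < ℓ k j) {k i : ℕ}
    (hi : i < height k) {B : Set (space lam ℓ)} (hB : MeasurableSet B) {t : ENNReal}
    (h : levelProb lam ℓ k i B < ENNReal.ofReal (lam / (1 + lam)) * t) :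
    levelProb lam ℓ (k + 1) i B < t ∧ levelProb lam ℓ (k + 1) (i + height k) B < t := by
  rw [levelProb_eq hlam hℓ hi hB] at h
  constructor
  · refine lt_of_mul_lt_mul_left' (lt_of_le_of_lt ?_ (le_self_add.trans_lt h))
    gcongr
  · exact lt_of_mul_lt_mul_left' (le_add_self.trans_lt h)

end ergodic

/-! ### Isometric coefficients. -/

section isometric

theorem ae_iterate_eq {X Y : Type*} [MeasurableSpace X] {μ : Measure X} {S : X → X} {T : Y → Y}
    {φ : X → Y} (hS : Measure.QuasiMeasurePreserving S μ μ) (h : ∀ᵐ x ∂μ, T (φ x) = φ (S x))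
    (n : ℕ) : ∀ᵐ x ∂μ, T^[n] (φ x) = φ (S^[n] x) := by
  induction n with
  | zero => exact .of_forall fun _ => rfl
  | succ n ih =>
    filter_upwards [ih, (hS.iterate n).ae h] with x h1 h2
    rw [Function.iterate_succ_apply', Function.iterate_succ_apply', h1, h2]

theorem isometry_iterate {Z : Type*} [PseudoEMetricSpace Z] {f : Z → Z} (hf : Isometry f) (n : ℕ) :
    Isometry f^[n] := by
  induction n with
  | zero => exact isometry_id
  | succ n ih => exact ih.comp hf

variable {lam : ℝ} {ℓ : ℕ → ℕ → ℝ} {Y : Type*} [MetricSpace Y] {T : Y → Y} {φ : space lam ℓ → Y}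

/-- If `φ` is close to `y` on most of both pieces of a level of column `k`, then `T ^ h_k` nearly
fixes `y`. -/
theorem dist_iterate_height_lt (hlam : 0 < lam) (hℓ : ∀ k j, 0 < ℓ k j) (hT : Isometry T)
    (h : ∀ᵐ x ∂measure lam ℓ, T (φ x) = φ (map hlam hℓ x)) {y : Y} {ε : ℝ}
    {k i : ℕ} (hi : i < height k)
    (h1 : levelProb lam ℓ (k + 1) i (φ ⁻¹' Metric.ball y ε)ᶜ < 2⁻¹)
    (h2 : levelProb lam ℓ (k + 1) (i + height k) (φ ⁻¹' Metric.ball y ε)ᶜ < 2⁻¹) :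
    dist (T^[height k] y) y < 2 * ε := by
  have hi1 : i < height (k + 1) := by rw [height_succ]; omega
  have hi2 : i + height k < height (k + 1) := by rw [height_succ]; omega
  -- `S^{h_k}` carries the left piece onto the right one; both exceptional sets are now measured in
  -- the left piece, where together they leave room for a good point.
  rw [← levelProb_preimage_iterate hlam hℓ hi2] at h2
  have := isProbabilityMeasure_levelProb hlam hℓ hi1
  have hlt := (measure_union_le _ _).trans_lt (ENNReal.add_lt_add h1 h2)
  rw [ENNReal.inv_two_add_inv_two] at hlt
  have hae := (levelProb_absolutelyContinuous (k + 1) i).ae_le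
    (ae_iterate_eq (quasiErgodic_map hlam hℓ).toQuasiMeasurePreserving h (height k))
  obtain ⟨x, hx, hxe⟩ : ∃ x, x ∉ (φ ⁻¹' Metric.ball y ε)ᶜ ∪
      (map hlam hℓ)^[height k] ⁻¹' (φ ⁻¹' Metric.ball y ε)ᶜ ∧
      T^[height k] (φ x) = φ ((map hlam hℓ)^[height k] x) := by
    by_contra! H
    refine hlt.ne (le_antisymm prob_le_one ?_)
    rw [← measure_univ (μ := levelProb lam ℓ (k + 1) i)]
    refine measure_mono_ae ?_
    filter_upwards [hae] with x hx _
    by_contra hx'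
    exact H x hx' hx
  simp only [mem_union, mem_compl_iff, mem_preimage, not_or, not_not, Metric.mem_ball] at hx
  calc dist (T^[height k] y) y
      ≤ dist (T^[height k] y) (T^[height k] (φ x)) + dist (T^[height k] (φ x)) y :=
        dist_triangle _ _ _
    _ < ε + ε := by
        refine add_lt_add ?_ (hxe ▸ hx.2)
        rw [(isometry_iterate hT _).dist_eq, dist_comm]
        exact hx.1
    _ = 2 * ε := by ring

theorem dist_iterate_mul_le {Z : Type*} [PseudoMetricSpace Z] {f : Z → Z} (hf : Isometry f) (z : Z)
    (n : ℕ) : dist (f^[n] z) z ≤ n * dist (f z) z := by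
  induction n with
  | zero => simp
  | succ n ih =>
    rw [Function.iterate_succ_apply]
    have h1 := dist_triangle (f^[n] (f z)) (f^[n] z) z
    rw [(isometry_iterate hf n).dist_eq] at h1
    push_cast
    linarith

theorem ae_eq_const_of_isometry [TopologicalSpace.SeparableSpace Y] [MeasurableSpace Y]
    [BorelSpace Y] (hlam : 0 < lam) (hlam1 : lam ≤ 1) (hℓ : ∀ k j, 0 < ℓ k j) (hT : Isometry T)
    (hφ : Measurable φ)
    (h : ∀ᵐ x ∂measure lam ℓ, T (φ x) = φ (map hlam hℓ x)) :
    ∃ y : Y, ∀ᵐ x ∂measure lam ℓ, φ x = y := by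
  have : Nonempty Y := ⟨φ ⟨0, zero_mem_space⟩⟩
  have := UniformSpace.secondCountable_of_separable Y
  have herg := quasiErgodic_map hlam hℓ
  have hTφ : Measurable fun x => dist (T (φ x)) (φ x) :=
    (hT.continuous.measurable.comp hφ).dist hφ
  -- The displacement `d(T φ(x), φ(x))` is invariant because `T` is an isometry.
  obtain ⟨c, hc⟩ := herg.ae_eq_const_of_ae_eq_comp_ae hTφ.aestronglyMeasurable (by
    filter_upwards [h, herg.toQuasiMeasurePreserving.ae h] with x h1 h2
    rw [Function.comp_apply, ← h1, hT.dist_eq])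
  have hμ : measure lam ℓ univ ≠ 0 := fun h0 =>
    measure_levelSet_ne_zero hlam hℓ (height_pos 0) (measure_mono_null (subset_univ _) h0)
  have hc0 : c ≤ 0 := by
    by_contra! hc0
    -- Here `12 = 10 + 2`: `T` will move `y` by less than `10ε`, and replacing `y` by a point of the
    -- ball costs `2ε` more.
    set ε := c / 12 with hε
    obtain ⟨y, hy⟩ : ∃ y, measure lam ℓ (φ ⁻¹' Metric.ball y ε) ≠ 0 := by
      by_contra! H
      refine hμ (measure_mono_null ?_ (measure_iUnion_null fun n : ℕ =>
        H (TopologicalSpace.denseSeq Y n)))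
      intro x _
      obtain ⟨n, hn⟩ := (TopologicalSpace.denseRange_denseSeq Y).exists_dist_lt (φ x)
        (show 0 < ε by positivity)
      exact mem_iUnion.mpr ⟨n, hn⟩
    have hA : MeasurableSet (φ ⁻¹' Metric.ball y ε) := hφ Metric.isOpen_ball.measurableSet
    set q := ENNReal.ofReal (lam / (1 + lam)) with hq
    have hq0 : q ≠ 0 := by
      rw [hq]
      simp only [ne_eq, ENNReal.ofReal_eq_zero, not_le]
      positivity
    have hq1 : q * 2⁻¹ ≤ 2⁻¹ := mul_le_of_le_one_left' (ENNReal.ofReal_le_one.mpr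
      ((div_le_one (by positivity)).mpr (by linarith)))
    -- One factor `q` for each of two cuts, leaving less than one half in the pieces in column `k +
    -- 2`.
    obtain ⟨k, i, hi, hlt⟩ := exists_levelProb_compl_lt hlam hℓ hA hy (δ := q * (q * 2⁻¹))
      (by simp [hq0])
    obtain ⟨h1, h2⟩ := levelProb_succ_lt hlam hlam1 hℓ hi hA.compl hlt
    have hi1 : i < height (k + 1) := by rw [height_succ]; omega
    obtain ⟨h3, h4⟩ := levelProb_succ_lt hlam hlam1 hℓ hi1 hA.compl h1
    have d1 := dist_iterate_height_lt hlam hℓ hT h hi (h1.trans_le hq1) (h2.trans_le hq1)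
    have d2 := dist_iterate_height_lt hlam hℓ hT h hi1 h3 h4
    have d3 := dist_iterate_mul_le (isometry_iterate hT (height k)) y 4
    rw [← Function.iterate_mul, mul_comm] at d3
    rw [height_succ, Function.iterate_succ_apply] at d2
    -- `10 = 4·2 + 2`: four applications of `T^{h_k}` and one of `T^{h_{k+1}} = T^{4h_k} ∘ T`.
    have d4 : dist (T y) y < 10 * ε := by
      rw [← (isometry_iterate hT (4 * height k)).dist_eq]
      have := dist_triangle_right (T^[4 * height k] (T y)) (T^[4 * height k] y) y
      push_cast at d3
      linarith
    obtain ⟨x, hx, hxc⟩ : ∃ x ∈ φ ⁻¹' Metric.ball y ε, dist (T (φ x)) (φ x) = c := by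
      by_contra! H
      exact hy (measure_mono_null (fun x hx => H x hx) hc)
    have hx : dist (φ x) y < ε := hx
    have d5 := dist_triangle4 (T (φ x)) (T y) y (φ x)
    rw [hT.dist_eq, dist_comm y] at d5
    linarith
  refine herg.ae_eq_const_of_ae_eq_comp_ae hφ.aestronglyMeasurable ?_
  filter_upwards [hc, h] with x h1 h2
  rw [Function.comp_apply, ← h2]
  exact dist_le_zero.mp (h1.trans_le hc0)

end isometric
end HKTower

theorem mainTheorem2 (lam : ℝ) (hlam0 : 0 < lam) (hlam1 : lam < 1)
    (ℓ : ℕ → ℕ → ℝ) (hℓ : ∀ k j, 0 < ℓ k j) :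
    HKTower.IsNonsingular (HKTower.measure lam ℓ) (HKTower.map hlam0 hℓ) ∧
      ∀ (Y : Type*) [MetricSpace Y] [TopologicalSpace.SeparableSpace Y]
        [MeasurableSpace Y] [BorelSpace Y] (T : Y → Y) (φ : HKTower.space lam ℓ → Y),
        Isometry T → Measurable φ →
        (∀ᵐ x ∂HKTower.measure lam ℓ, T (φ x) = φ (HKTower.map hlam0 hℓ x)) →
        ∃ y : Y, ∀ᵐ x ∂HKTower.measure lam ℓ, φ x = y :=
  ⟨HKTower.isNonsingular_map hlam0 hℓ, fun _ _ _ _ _ _ _ hT hφ h =>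
    HKTower.ae_eq_const_of_isometry hlam0 hlam1.le hℓ hT hφ h⟩
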